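/- For graphs $G$ and $H$, the $(G,H)$-online Ramsey game is played by Builder and Painter on an infinite set of vertices, initially without edges. In each round Builder draws an edge between two distinct nonadjacent vertices, and Painter immediately colours it red or blue. The online Ramsey number $\tilde r(G,H)$ is the least $n$ such that Builder can guarantee, whatever Painter does, that a red copy of $G$ or a blue copy of $H$ (as a not necessarily induced subgraph) exists after at most $n$ rounds. Theorem. Let $K_{1,3}$ be the star with three edges and $P_\ell$ the path with $\ell$ vertices. For every integer $\ell\ge 2$, $$\tilde r(K_{1,3},P_\ell)=\left\lfloor \tfrac{3\ell}{2}\right\rfloor .$$ -/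

import Mathlib

/-- Builder can guarantee a win of the `(G, H)`-online Ramsey game within `n` further rounds, when
the edges drawn so far are those of `R` (coloured red) and those of `B` (coloured blue).
Builder has won as soon as there is a red copy of `G` or a blue copy of `H` (not necessarily
induced). Otherwise, if a round is left, Builder has to choose two distinct vertices not yet joined
by an edge such that Builder can guarantee a win in the remaining rounds whichever of the two
colours Painter gives to the new edge. -/
def BuilderWinsWithin {V α β : Type*} (G : SimpleGraph α) (H : SimpleGraph β) :
    ℕ → SimpleGraph V → SimpleGraph V → Prop
  | 0, R, B => G.IsContained R ∨ H.IsContained B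
  | n + 1, R, B => (G.IsContained R ∨ H.IsContained B) ∨
      ∃ u v : V, u ≠ v ∧ ¬ R.Adj u v ∧ ¬ B.Adj u v ∧
        BuilderWinsWithin G H n (R ⊔ SimpleGraph.edge u v) B ∧
        BuilderWinsWithin G H n R (B ⊔ SimpleGraph.edge u v)

/-- The online Ramsey number of `G` versus `H`, for the game played on the vertex set `V` (an
infinite set in the standard game): the least number of rounds within which Builder can guarantee a
win from the edgeless graph, and `⊤` if there is no such number. -/
noncomputable def onlineRamseyNumber (V : Type*) {α β : Type*}
    (G : SimpleGraph α) (H : SimpleGraph β) : ℕ∞ :=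
  ⨅ (n : ℕ) (_ : BuilderWinsWithin G H n (⊥ : SimpleGraph V) (⊥ : SimpleGraph V)), (n : ℕ∞)

open SimpleGraph

/-! Upper bound. Once a vertex has two red edges, every further edge at it must be blue. While
Painter keeps extending a red path, each new red edge saturates one vertex, and two forced blue
edges add that vertex and a fresh one to a blue path: three rounds for two vertices, which is the
rate `3/2`. A blue answer lengthens the path cheaply, and the round saved pays for moving to a
different kind of position. Positions are measured by the number `q` of vertices still missing.
Passing from `q` to `q - 2` lowers `3 * q / 2` by exactly three, so only the additive constant of
each budget has to be tracked: `0` for `saturatedEnd` and `redEdge`, `1` for `WinsFromEnds`,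
`pendant` and `chain`, `2` for `WinsFromReserve`, `oneEnd` and `absorb`. `WinsFromEnds` and
`WinsFromReserve` are obtained by one simultaneous strong induction on `q`, and `wins_of_two_le`
steers the opening into these positions.

Lower bound. Put `m = ℓ / 2`. Painter answers red unless an end already has red degree two, or the
edge would be the `m`-th red one and leave no vertex of red degree one. No red star arises. A vertex
of red degree two meets at most two edges of a blue path, so the `ℓ - 1` edges of the path could be
covered with only `m` red edges just when these form disjoint cycles. The second exception excludes
this, and the few blue edges it leaves uncovered do not compensate (`PainterInvariant.not_won`).
Thus Builder needs at least `m + 1` red and `ℓ - 1` blue edges. -/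

/-! ### Blue paths with prescribed ends and vertex set -/

/-- `BluePath B x y S`: the graph `B` has a path from `x` to `y` with vertex set `S`. -/
inductive BluePath {V : Type*} [DecidableEq V] (B : SimpleGraph V) : V → V → Finset V → Prop
  | single (v : V) : BluePath B v v {v}
  | cons {u x y : V} {S : Finset V} : B.Adj u x → u ∉ S → BluePath B x y S →
      BluePath B u y (insert u S)

namespace BluePath

variable {V : Type*} [DecidableEq V] {B B' : SimpleGraph V} {x y u v : V} {S T : Finset V}

theorem mono (h : BluePath B x y S) (hB : B ≤ B') : BluePath B' x y S := by
  induction h with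
  | single v => exact .single v
  | cons h1 h2 _ ih => exact .cons (hB h1) h2 ih

theorem left_mem (h : BluePath B x y S) : x ∈ S := by
  cases h <;> simp

theorem right_mem (h : BluePath B x y S) : y ∈ S := by
  induction h with
  | single v => simp
  | cons h1 h2 _ ih => simp [ih]

theorem join (h : BluePath B x y S) (h' : BluePath B u v T) (hST : Disjoint S T)
    (ha : B.Adj y u) : BluePath B x v (S ∪ T) := by
  induction h with
  | single w => exact .cons ha (by simpa using hST) h'
  | cons h1 h2 _ ih =>
    rw [Finset.disjoint_insert_left] at hST
    rw [Finset.insert_union]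
    exact .cons h1 (by simp [h2, hST.1]) (ih hST.2 ha)

theorem snoc (h : BluePath B x y S) (hu : u ∉ S) (ha : B.Adj y u) :
    BluePath B x u (insert u S) := by
  have := h.join (.single u) (by simpa using hu) ha
  rwa [Finset.union_comm] at this

theorem symm (h : BluePath B x y S) : BluePath B y x S := by
  induction h with
  | single v => exact .single v
  | cons h1 h2 _ ih => exact ih.snoc h2 h1.symm

theorem exists_list (h : BluePath B x y S) :
    ∃ l : List V, (x :: l).IsChain B.Adj ∧ (x :: l).Nodup ∧ (x :: l).toFinset = S := by
  induction h with
  | single v => exact ⟨[], by simp⟩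
  | @cons u x y S h1 h2 _ ih =>
    obtain ⟨l, hc, hn, hS⟩ := ih
    refine ⟨x :: l, List.isChain_cons_cons.2 ⟨h1, hc⟩, List.nodup_cons.2 ⟨?_, hn⟩, ?_⟩
    · rwa [← List.mem_toFinset, hS]
    · rw [List.toFinset_cons, hS]

theorem isContained {ℓ : ℕ} (h : BluePath B x y S) (hℓ : ℓ ≤ S.card) :
    (pathGraph ℓ).IsContained B := by
  obtain ⟨l, hc, hn, rfl⟩ := h.exists_list
  rw [List.toFinset_card_of_nodup hn] at hℓ
  generalize x :: l = L at hc hn hℓ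
  have key : ∀ i j : Fin ℓ, i.1 + 1 = j.1 → B.Adj (L[i.1]) (L[j.1]) := by
    intro i j hij
    have := List.isChain_iff_getElem.1 hc i.1 (by omega)
    simpa [hij] using this
  refine ⟨⟨⟨fun i : Fin ℓ => L[i.1], ?_⟩, ?_⟩⟩
  · intro i j hij
    rw [pathGraph_adj] at hij
    rcases hij with h | h
    · exact key _ _ h
    · exact (key _ _ h).symm
  · intro i j hij
    exact Fin.ext ((List.Nodup.getElem_inj_iff hn).1 hij)

end BluePath

/-- Builder wins the `(K_{1,3}, P_ℓ)`-game within `n` further rounds. -/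
abbrev Wins {V : Type*} (ℓ n : ℕ) (R B : SimpleGraph V) : Prop :=
  BuilderWinsWithin (completeBipartiteGraph (Fin 1) (Fin 3)) (pathGraph ℓ) n R B

/-! ### Monotonicity of the game -/

section Monotone

variable {V α β : Type*} {G : SimpleGraph α} {H : SimpleGraph β}

theorem BuilderWinsWithin.of_won {R B : SimpleGraph V} (n : ℕ)
    (h : G.IsContained R ∨ H.IsContained B) : BuilderWinsWithin G H n R B := by
  cases n
  · exact h
  · exact Or.inl h

theorem BuilderWinsWithin.succ : ∀ {n : ℕ} {R B : SimpleGraph V},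
    BuilderWinsWithin G H n R B → BuilderWinsWithin G H (n + 1) R B
  | 0, _, _, h => Or.inl h
  | _ + 1, _, _, .inl h => Or.inl h
  | _ + 1, _, _, .inr ⟨u, v, h1, h2, h3, h4, h5⟩ => Or.inr ⟨u, v, h1, h2, h3, h4.succ, h5.succ⟩

/-- Extra edges only help: if the strategy asks for a pair that is already joined, the branch
belonging to its colour applies, and the unused round does no harm. -/
theorem BuilderWinsWithin.mono_graph : ∀ {n : ℕ} {R R' B B' : SimpleGraph V},
    BuilderWinsWithin G H n R B → R ≤ R' → B ≤ B' → BuilderWinsWithin G H n R' B'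
  | 0, _, _, _, _, h, hR, hB => h.imp (fun h => h.mono_right hR) (fun h => h.mono_right hB)
  | n + 1, R, R', B, B', h, hR, hB => by
    rcases h with h | ⟨u, v, h1, h2, h3, h4, h5⟩
    · exact Or.inl (h.imp (fun h => h.mono_right hR) (fun h => h.mono_right hB))
    · by_cases hr : R'.Adj u v
      · exact (h4.mono_graph (sup_le hR ((edge_le_iff _).2 (.inr hr))) hB).succ
      by_cases hb : B'.Adj u v
      · exact (h5.mono_graph hR (sup_le hB ((edge_le_iff _).2 (.inr hb)))).succ
      exact Or.inr ⟨u, v, h1, hr, hb, h4.mono_graph (sup_le_sup_right hR _) hB,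
        h5.mono_graph hR (sup_le_sup_right hB _)⟩

/-- Builder may draw any edge, even one that is already present. -/
theorem BuilderWinsWithin.draw {r : ℕ} {R B : SimpleGraph V} {u v : V} (hr : 1 ≤ r) (huv : u ≠ v)
    (h4 : ∀ R', R ≤ R' → R'.Adj u v → BuilderWinsWithin G H (r - 1) R' B)
    (h5 : ∀ B', B ≤ B' → B'.Adj u v → BuilderWinsWithin G H (r - 1) R B') :
    BuilderWinsWithin G H r R B := by
  obtain ⟨n, rfl⟩ : ∃ n, r = n + 1 := ⟨r - 1, by omega⟩
  by_cases hr : R.Adj u v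
  · exact (h4 R le_rfl hr).succ
  by_cases hb : B.Adj u v
  · exact (h5 B le_rfl hb).succ
  have he : (edge u v).Adj u v := by simp [edge_adj, huv]
  exact Or.inr ⟨u, v, huv, hr, hb, h4 _ le_sup_left (Or.inr he), h5 _ le_sup_left (Or.inr he)⟩

end Monotone

theorem isContained_star_of_adj {V : Type*} {R : SimpleGraph V} {u a b c : V} (ha : R.Adj u a)
    (hb : R.Adj u b) (hc : R.Adj u c) (hab : a ≠ b) (hac : a ≠ c) (hbc : b ≠ c) :
    (completeBipartiteGraph (Fin 1) (Fin 3)).IsContained R := by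
  have key : ∀ j : Fin 3, R.Adj u (![a, b, c] j) := by
    intro j; fin_cases j <;> simp [ha, hb, hc]
  refine ⟨⟨⟨Sum.elim (fun _ => u) ![a, b, c], ?_⟩, ?_⟩⟩
  · rintro (i | i) (j | j) h
    · simp [completeBipartiteGraph] at h
    · exact key j
    · exact (key i).symm
    · simp [completeBipartiteGraph] at h
  · have hi : Function.Injective ![a, b, c] := by
      intro i j
      fin_cases i <;> fin_cases j <;> simp [hab, hac, hbc, hab.symm, hac.symm, hbc.symm]
    rintro (i | i) (j | j) h
    · simp [Subsingleton.elim i j]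
    · exact absurd h (key j).ne
    · exact absurd h.symm (key i).ne
    · exact congrArg _ (hi h)

/-! ### Basic moves of Builder -/

/-- The vertex `v` has two red neighbours, so that further edges at `v` have to be blue. -/
def Saturated {V : Type*} (R : SimpleGraph V) (v a b : V) : Prop := R.Adj v a ∧ R.Adj v b ∧ a ≠ b

section Strategy

variable {V : Type*} {ℓ : ℕ} {R B : SimpleGraph V}

theorem Saturated.mono {R' : SimpleGraph V} {v a b : V} (h : Saturated R v a b) (hR : R ≤ R') :
    Saturated R' v a b := ⟨hR h.1, hR h.2.1, h.2.2⟩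

/-- A red answer would complete the star at `u`; `a ≠ v` and `b ≠ v` keep its three leaves distinct.
-/
theorem Wins.force {r : ℕ} {u v a b : V} (hr : 1 ≤ r) (hs : Saturated R u a b) (huv : u ≠ v)
    (ha : a ≠ v) (hb : b ≠ v) (h : ∀ B', B ≤ B' → B'.Adj u v → Wins ℓ (r - 1) R B') :
    Wins ℓ r R B :=
  BuilderWinsWithin.draw hr huv
    (fun _ hR' huv' => .of_won _ (.inl (isContained_star_of_adj (hR' hs.1) (hR' hs.2.1) huv'
      hs.2.2 ha hb))) h

variable [DecidableEq V]

theorem BluePath.wins {x y : V} {S : Finset V} (h : BluePath B x y S) (hS : ℓ ≤ S.card) (r : ℕ) :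
    Wins ℓ r R B := .of_won _ (.inr (h.isContained hS))

/-- A path is prolonged within two rounds at an end that has a red neighbour. -/
theorem BluePath.wins_of_end [Infinite V] {x y w : V} {S : Finset V} {r : ℕ}
    (h : BluePath B x y S) (hS : ℓ ≤ S.card + 1) (hw : R.Adj y w) (hr : 2 ≤ r) : Wins ℓ r R B := by
  obtain ⟨u, hu⟩ := Infinite.exists_notMem_finset (insert w S)
  obtain ⟨v, hv⟩ := Infinite.exists_notMem_finset (insert u (insert w S))
  simp only [Finset.mem_insert, not_or] at hu hv
  have hy := h.right_mem
  refine .draw (by omega) (u := y) (v := u) (by grind) (fun R' hR hyu => ?_) (fun B' hB hyu => ?_)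
  · refine Wins.force (by omega) ⟨hR hw, hyu, by grind⟩ (v := v) (by grind) (by grind) (by grind)
      (fun B' hB hyv => ?_)
    exact ((h.mono hB).snoc hv.2.2 hyv).wins (by simpa [hv.2.2] using hS) _
  · exact ((h.mono hB).snoc hu.2 hyu).wins (by simpa [hu.2] using hS) _

/-- A path with an end that has a red neighbour absorbs a second path within two rounds. -/
theorem BluePath.attach {x y w d e : V} {S T : Finset V} {r : ℕ} (h : BluePath B x y S)
    (hw : R.Adj y w) (hD : BluePath B d e T) (hST : Disjoint S T) (hde : d ≠ e) (hwd : w ≠ d)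
    (hwe : w ≠ e) (hr : 2 ≤ r)
    (hblue : ∀ B', B ≤ B' → BluePath B' x e (S ∪ T) → Wins ℓ (r - 1) R B')
    (hred : ∀ R' B', R ≤ R' → B ≤ B' → R'.Adj y d → BluePath B' x d (S ∪ T) →
      Wins ℓ (r - 2) R' B') : Wins ℓ r R B := by
  have hyT : y ∉ T := Finset.disjoint_left.1 hST h.right_mem
  refine .draw (by omega) (u := y) (v := d) (fun h => hyT (h ▸ hD.left_mem)) (fun R' hR hyd => ?_)
    (fun B' hB hyd => hblue B' hB ((h.mono hB).join (hD.mono hB) hST hyd))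
  -- The second path is now traversed backwards, so the new end `d` has the red neighbour `y`; this
  -- is the gain for the extra round.
  refine Wins.force (by omega) ⟨hR hw, hyd, hwd⟩ (v := e) (fun h => hyT (h ▸ hD.right_mem)) hwe hde
    (fun B' hB hye => ?_)
  exact hred R' B' hR hB hyd ((h.mono hB).join (hD.mono hB).symm hST hye)

end Strategy

/-! ### Positions with one main blue path -/

section Positions

variable {V : Type*} [DecidableEq V]

/-- Builder wins if `q` more vertices are needed on a blue path both of whose ends have a red
neighbour, and at least `⌊3q/2⌋ + 1` rounds are left. -/
def WinsFromEnds (V : Type*) [DecidableEq V] (ℓ q : ℕ) : Prop :=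
  ∀ ⦃r : ℕ⦄ ⦃R B : SimpleGraph V⦄ ⦃x y z w : V⦄ ⦃S : Finset V⦄, BluePath B x y S →
    ℓ ≤ S.card + q → R.Adj x z → R.Adj y w → 3 * q / 2 + 1 ≤ r → Wins ℓ r R B

/-- As `WinsFromEnds`, with a second blue path, one of whose ends is saturated. -/
def WinsFromReserve (V : Type*) [DecidableEq V] (ℓ q : ℕ) : Prop :=
  ∀ ⦃r : ℕ⦄ ⦃R B : SimpleGraph V⦄ ⦃x y z w c d c₁ c₂ : V⦄ ⦃S T : Finset V⦄, BluePath B x y S →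
    BluePath B c d T → Disjoint S T → Saturated R c c₁ c₂ → ℓ ≤ S.card + T.card + q →
    R.Adj x z → R.Adj y w → z ≠ d → w ≠ d → 3 * q / 2 + 2 ≤ r → Wins ℓ r R B

variable [Infinite V] {ℓ q r : ℕ} {R B : SimpleGraph V}

/-- Builder probes the other end: a blue answer gains a vertex for one round, a red one supplies the
missing red neighbour. -/
theorem WinsFromEnds.oneEnd (hK : ∀ p ≤ q, WinsFromEnds V ℓ p) {x y z : V} {S : Finset V}
    (hP : BluePath B x y S) (hS : ℓ ≤ S.card + q) (hz : R.Adj x z) (hr : 3 * q / 2 + 2 ≤ r) :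
    Wins ℓ r R B := by
  induction q generalizing r B y S with
  | zero => exact hP.wins hS _
  | succ q ih =>
    obtain ⟨v, hv⟩ := Infinite.exists_notMem_finset S
    have hy := hP.right_mem
    refine .draw (by omega) (u := y) (v := v) (by grind) (fun R' hR hyv => ?_)
      (fun B' hB hyv => ?_)
    · exact hK (q + 1) le_rfl hP hS (hR hz) hyv (by omega)
    · refine ih (fun p hp => hK p (by omega)) ((hP.mono hB).snoc hv hyv) ?_ (by omega)
      rw [Finset.card_insert_of_notMem hv]; omega

/-- Builder draws `au` with `u` fresh. If it is red, `a` is saturated, and the forced edges `ev`,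
`va` reproduce the position with end `a` and pendant red edge `ua`. If it is blue, the single forced
edge `eu` appends `u` and `a`, and `b` is a red neighbour of the new end. -/
theorem WinsFromEnds.saturatedEnd (hK : ∀ p < q, WinsFromEnds V ℓ p) {x e z e₁ e₂ a b : V}
    {S : Finset V} (hP : BluePath B x e S) (hS : ℓ ≤ S.card + q) (hz : R.Adj x z)
    (he : Saturated R e e₁ e₂) (ha : a ∉ S) (hb : R.Adj a b) (hr : 3 * q / 2 ≤ r) :
    Wins ℓ r R B := by
  induction q using Nat.strong_induction_on generalizing r R B e e₁ e₂ a b S with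
  | _ q ih =>
  have heS := hP.right_mem
  obtain ⟨u, hu⟩ := Infinite.exists_notMem_finset (S ∪ {a, b, e₁, e₂})
  obtain ⟨v, hv⟩ := Infinite.exists_notMem_finset (S ∪ {a, b, u, e₁, e₂})
  simp only [Finset.mem_union, Finset.mem_insert, Finset.mem_singleton, not_or] at hu hv
  rcases Nat.lt_or_ge q 2 with hq | hq
  · rcases Nat.eq_zero_or_pos q with rfl | hq0
    · exact hP.wins hS _
    refine Wins.force (by omega) he (v := v) (by grind) (by grind) (by grind)
      (fun B' hB hev => ?_)
    exact ((hP.mono hB).snoc hv.1 hev).wins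
      (by rw [Finset.card_insert_of_notMem hv.1]; omega) _
  refine .draw (by omega) (u := a) (v := u) (by grind) (fun R' hR hau => ?_)
    (fun B' hB hau => ?_)
  · refine Wins.force (by omega) (he.mono hR) (v := v) (by grind) (by grind) (by grind)
      (fun B' hB hev => ?_)
    have ha' : Saturated R' a b u := ⟨hR hb, hau, by grind⟩
    refine Wins.force (by omega) ha' (v := v) (by grind) (by grind) (by grind)
      (fun B'' hB' hav => ?_)
    have hP' := (((hP.mono hB).snoc hv.1 hev).mono hB').snoc (u := a) (by grind) hav.symm
    refine ih (q - 2) (by omega) (fun p hp => hK p (by omega)) hP' ?_ (hR hz) ha' (a := u)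
      (by grind) hau.symm (by omega)
    rw [Finset.card_insert_of_notMem (by grind), Finset.card_insert_of_notMem hv.1]; omega
  · refine Wins.force (by omega) he (v := u) (by grind) (by grind) (by grind)
      (fun B'' hB' heu => ?_)
    have hP' := ((hP.mono (hB.trans hB')).snoc hu.1 heu).snoc (u := a) (by grind) (hB' hau).symm
    refine hK (q - 2) (by omega) hP' ?_ hz hb (by omega)
    rw [Finset.card_insert_of_notMem (by grind), Finset.card_insert_of_notMem hu.1]; omega

/-- Builder draws `ya`. A blue answer makes `a`, with its red neighbour `b`, the new end. A red
answer saturates `a` and gives `y` a red neighbour, so a forced edge at `a` starts a reserve path.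
-/
theorem WinsFromEnds.pendant (hK : ∀ p < q, WinsFromEnds V ℓ p)
    (hK' : ∀ p < q, WinsFromReserve V ℓ p) {x y z a b : V} {S : Finset V} (hP : BluePath B x y S)
    (hS : ℓ ≤ S.card + q) (hz : R.Adj x z) (ha : a ∉ S) (hb : R.Adj a b) (hby : b ≠ y)
    (hr : 3 * q / 2 + 1 ≤ r) : Wins ℓ r R B := by
  have hyS := hP.right_mem
  rcases Nat.lt_or_ge q 2 with hq | hq
  · rcases Nat.eq_zero_or_pos q with rfl | hq0
    · exact hP.wins hS _
    exact hP.symm.wins_of_end (by omega) hz (by omega)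
  refine .draw (by omega) (u := y) (v := a) (by grind) (fun R' hR hya => ?_)
    (fun B' hB hya => ?_)
  · obtain ⟨v, hv⟩ := Infinite.exists_notMem_finset (S ∪ {a, b, y, z})
    simp only [Finset.mem_union, Finset.mem_insert, Finset.mem_singleton, not_or] at hv
    have ha' : Saturated R' a b y := ⟨hR hb, hya.symm, hby⟩
    refine Wins.force (by omega) ha' (v := v) (by grind) (by grind) (by grind)
      (fun B' hB hav => ?_)
    refine hK' (q - 2) (by omega) (hP.mono hB) (.cons hav (by grind) (.single v)) ?_
      ha' ?_ (hR hz) hya (by grind) (by grind) (by omega)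
    · simp [ha, hv.1]
    · rw [Finset.card_insert_of_notMem (by grind), Finset.card_singleton]; omega
  · refine hK (q - 1) (by omega) ((hP.mono hB).snoc ha hya) ?_ hz hb (by omega)
    rw [Finset.card_insert_of_notMem ha]; omega

end Positions

/-! ### Growing a red path and a reserve path; the simultaneous induction -/

section Chains

variable {V : Type*} [DecidableEq V] [Infinite V] {ℓ q r : ℕ} {R B : SimpleGraph V}

/-- Builder absorbs a path that starts at an end `e` of a red path into the main blue path. -/
theorem WinsFromEnds.absorb (hK : ∀ p ≤ q, WinsFromEnds V ℓ p)
    (hK' : ∀ p < q, WinsFromReserve V ℓ p) {x y z w a b d e f : V} {S T : Finset V}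
    (hP : BluePath B x y S) (hD : BluePath B e d T) (hST : Disjoint S T) (hed : e ≠ d)
    (hS : ℓ ≤ S.card + T.card + q) (hz : R.Adj x z) (hw : R.Adj y w) (hwd : w ≠ d) (hwe : w ≠ e)
    (haS : a ∉ S) (haT : a ∉ T) (hb : R.Adj a b) (hbd : b ≠ d) (hf : R.Adj e f) (hfy : f ≠ y)
    (hr : 3 * q / 2 + 2 ≤ r) : Wins ℓ r R B := by
  have hc := Finset.card_union_of_disjoint hST
  have ha : a ∉ S ∪ T := by simp [haS, haT]
  refine hP.attach hw hD hST hed hwe hwd (by omega) (fun B' hB hP' => ?_)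
    (fun R' B' hR hB hye hP' => ?_)
  · exact WinsFromEnds.pendant (fun p hp => hK p hp.le) hK' hP' (by omega) hz ha hb hbd (by omega)
  · exact WinsFromEnds.saturatedEnd (fun p hp => hK p hp.le) hP' (by omega) (hR hz)
      ⟨hR hf, hye.symm, hfy⟩ ha (hR hb) (by omega)

/-- The case that the recursion of `chain` cannot reach. Builder tests `ya`, then `xe`, then `av`;
the first red answer saturates an end of the main path, which is then forced to join `d`. If all
three are blue, the forced edge `cv` joins the paths. -/
theorem WinsFromEnds.chain_three {x y z w a b c d e f c₁ c₂ : V} {S T : Finset V}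
    (hP : BluePath B x y S) (hD : BluePath B c d T) (hST : Disjoint S T)
    (hc : Saturated R c c₁ c₂) (hS : ℓ ≤ S.card + T.card + 3) (hz : R.Adj x z) (hw : R.Adj y w)
    (hzd : z ≠ d) (hwd : w ≠ d) (hze : z ≠ e) (hwa : w ≠ a) (haS : a ∉ S) (haT : a ∉ T)
    (heS : e ∉ S) (heT : e ∉ T) (hae : a ≠ e) (hb : R.Adj a b) (hf : R.Adj e f) (hbS : b ∉ S)
    (hfS : f ∉ S) (hbd : b ≠ d) (hr : 5 ≤ r) : Wins ℓ r R B := by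
  have hxS := hP.left_mem
  have hyS := hP.right_mem
  have hcT := hD.left_mem
  have hdT := hD.right_mem
  have hdisj := Finset.disjoint_left.1 hST
  have hcard := Finset.card_union_of_disjoint hST
  obtain ⟨u, hu⟩ := Infinite.exists_notMem_finset (S ∪ T ∪ {a, b, e, f, z, w, c₁, c₂})
  obtain ⟨v, hv⟩ := Infinite.exists_notMem_finset (S ∪ T ∪ {a, b, e, f, z, w, c₁, c₂, u})
  simp only [Finset.mem_union, Finset.mem_insert, Finset.mem_singleton, not_or] at hu hv
  refine .draw (by omega) (u := y) (v := a) (by grind) (fun R' hR hya => ?_)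
    (fun B' hB hya => ?_)
  · refine Wins.force (by omega) ⟨hR hw, hya, hwa⟩ (v := d) (by grind) (by grind) (by grind)
      (fun B₁ hB₁ hyd => ?_)
    have h₁ := (hP.mono hB₁).join (hD.mono hB₁).symm hST hyd
    refine Wins.force (by omega) (hc.mono hR) (v := v) (by grind) (by grind) (by grind)
      (fun B₂ hB₂ hcv => ?_)
    have h₂ := (h₁.mono hB₂).snoc (u := v) (by grind) hcv
    have ha' : Saturated R' a b y := ⟨hR hb, hya.symm, by grind⟩
    refine Wins.force (by omega) ha' (v := v) (by grind) (by grind) (by grind)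
      (fun B₃ hB₃ hav => ?_)
    have h₃ := (h₂.mono hB₃).snoc (u := a) (by grind) hav.symm
    refine Wins.force (by omega) ha' (v := u) (by grind) (by grind) (by grind)
      (fun B₄ hB₄ hau => ?_)
    have h₄ := (h₃.mono hB₄).snoc (u := u) (by grind) hau
    refine h₄.wins ?_ _
    rw [Finset.card_insert_of_notMem (by grind), Finset.card_insert_of_notMem (by grind),
      Finset.card_insert_of_notMem (by grind)]
    omega
  · have h₁ := (hP.mono hB).snoc haS hya
    refine .draw (by omega) (u := x) (v := e) (by grind) (fun R' hR hxe => ?_)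
      (fun B₁ hB₁ hxe => ?_)
    · refine Wins.force (by omega) ⟨hR hz, hxe, hze⟩ (v := d) (by grind) (by grind) (by grind)
        (fun B₂ hB₂ hxd => ?_)
      have h₂ := (h₁.mono hB₂).symm.join ((hD.mono hB).mono hB₂).symm (by simp [haT, hST]) hxd
      refine Wins.force (by omega) (hc.mono hR) (v := v) (by grind) (by grind) (by grind)
        (fun B₃ hB₃ hcv => ?_)
      have h₃ := (h₂.mono hB₃).snoc (u := v) (by grind) hcv
      have he' : Saturated R' e f x := ⟨hR hf, hxe.symm, by grind⟩
      refine Wins.force (by omega) he' (v := v) (by grind) (by grind) (by grind)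
        (fun B₄ hB₄ hev => ?_)
      have h₄ := (h₃.mono hB₄).snoc (u := e) (by grind) hev.symm
      refine h₄.wins ?_ _
      rw [Finset.card_insert_of_notMem (by grind), Finset.card_insert_of_notMem (by grind),
        Finset.card_union_of_disjoint (by simp [haT, hST]), Finset.card_insert_of_notMem haS]
      omega
    · have h₂ := (h₁.mono hB₁).symm.snoc (u := e) (by grind) hxe
      have hdisj' : Disjoint (insert e (insert a S)) T := by simp [haT, heT, hST]
      refine .draw (by omega) (u := a) (v := v) (by grind) (fun R' hR hav => ?_)
        (fun B₂ hB₂ hav => ?_)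
      · refine Wins.force (by omega) ⟨hR hb, hav, by grind⟩ (v := d) (by grind) (by grind)
          (by grind) (fun B₂ hB₂ had => ?_)
        have h₃ := (h₂.mono hB₂).symm.join (((hD.mono hB).mono hB₁).mono hB₂).symm hdisj' had
        refine Wins.force (by omega) (hc.mono hR) (v := u) (by grind) (by grind) (by grind)
          (fun B₃ hB₃ hcu => ?_)
        have h₄ := (h₃.mono hB₃).snoc (u := u) (by grind) hcu
        refine h₄.wins ?_ _
        rw [Finset.card_insert_of_notMem (by grind), Finset.card_union_of_disjoint hdisj',
          Finset.card_insert_of_notMem (by grind), Finset.card_insert_of_notMem haS]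
        omega
      · have h₃ := (h₂.mono hB₂).symm.snoc (u := v) (by grind) hav
        have hdisj'' : Disjoint (insert v (insert e (insert a S))) T := by
          simp [haT, heT, hST, hv.1.2]
        refine Wins.force (by omega) hc (v := v) (by grind) (by grind) (by grind)
          (fun B₃ hB₃ hcv => ?_)
        have h₄ := (h₃.mono hB₃).join ((((hD.mono hB).mono hB₁).mono hB₂).mono hB₃)
          hdisj'' hcv.symm
        refine h₄.wins ?_ _
        rw [Finset.card_union_of_disjoint hdisj'', Finset.card_insert_of_notMem (by grind),
          Finset.card_insert_of_notMem (by grind), Finset.card_insert_of_notMem haS]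
        omega

/-- Builder wins from a position with a blue path, a red path with ends `a` and `e`, and a second
blue path that ends in a saturated vertex. -/
theorem WinsFromEnds.chain (hK : ∀ p < q, WinsFromEnds V ℓ p)
    (hK' : ∀ p < q, WinsFromReserve V ℓ p) {x y z w a b c d e f c₁ c₂ : V} {S T : Finset V}
    (hq : q ≠ 1)
    (hP : BluePath B x y S) (hD : BluePath B c d T) (hST : Disjoint S T)
    (hc : Saturated R c c₁ c₂) (hcy : q = 0 → c₁ ≠ y ∧ c₂ ≠ y)
    (hS : ℓ ≤ S.card + T.card + q) (hz : R.Adj x z) (hw : R.Adj y w)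
    (hzd : z ≠ d) (hwd : w ≠ d) (hze : z ≠ e) (hwe : w ≠ e) (hwa : w ≠ a) (haS : a ∉ S)
    (haT : a ∉ T) (heS : e ∉ S) (heT : e ∉ T) (hae : a ≠ e) (hb : R.Adj a b) (hf : R.Adj e f)
    (hbS : b ∉ S) (hfS : f ∉ S) (hbd : b ≠ d) (hr : 3 * q / 2 + 1 ≤ r) :
    Wins ℓ r R B := by
  induction q using Nat.strong_induction_on generalizing r R B c c₁ c₂ e f T with
  | _ q ih =>
  have hxS := hP.left_mem
  have hyS := hP.right_mem
  have hcT := hD.left_mem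
  have hdT := hD.right_mem
  have hdisj := Finset.disjoint_left.1 hST
  have hcard := Finset.card_union_of_disjoint hST
  rcases Nat.eq_zero_or_pos q with rfl | hq0
  · obtain ⟨h1, h2⟩ := hcy rfl
    refine Wins.force (by omega) hc (v := y) (by grind) h1 h2 (fun B' hB hcy => ?_)
    exact ((hP.mono hB).join (hD.mono hB) hST hcy.symm).wins (by omega) _
  -- The general move would lead from `3` to the excluded value `1`.
  by_cases hq3 : q = 3
  · subst hq3
    exact WinsFromEnds.chain_three hP hD hST hc hS hz hw hzd hwd hze hwa haS haT heS heT hae hb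
      hf hbS hfS hbd (by omega)
  obtain ⟨u, hu⟩ := Infinite.exists_notMem_finset (S ∪ T ∪ {a, b, e, f, z, w, c₁, c₂})
  obtain ⟨v, hv⟩ := Infinite.exists_notMem_finset (S ∪ T ∪ {a, b, e, f, z, w, c₁, c₂, u})
  simp only [Finset.mem_union, Finset.mem_insert, Finset.mem_singleton, not_or] at hu hv
  -- Builder prolongs the red path at `e`. Either answer lets the reserve path gain two vertices and
  -- end in `e`; after a red one `e` is saturated and `u` is the new end of the red path.
  refine .draw (by omega) (u := e) (v := u) (by grind) (fun R' hR heu => ?_)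
    (fun B' hB heu => ?_)
  · refine Wins.force (by omega) (hc.mono hR) (v := v) (by grind) (by grind) (by grind)
      (fun B₁ hB₁ hcv => ?_)
    have he' : Saturated R' e f u := ⟨hR hf, heu, by grind⟩
    refine Wins.force (by omega) he' (v := v) (by grind) (by grind) (by grind)
      (fun B₂ hB₂ hev => ?_)
    have hD' : BluePath B₂ e d (insert e (insert v T)) :=
      .cons hev (by grind) (.cons (hB₂ hcv).symm (by grind) ((hD.mono hB₁).mono hB₂))
    refine ih (q - 2) (by omega) (fun p hp => hK p (by omega)) (fun p hp => hK' p (by omega))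
      (by omega) ((hP.mono hB₁).mono hB₂) hD' ?_ he' (fun _ => by grind) ?_ (hR hz)
      (hR hw) (e := u) (by grind) (by grind) (by grind) (by grind) (by grind) (by grind)
      (hR hb) heu.symm heS (by omega)
    · simp [heS, hv.1.1, hST]
    · rw [Finset.card_insert_of_notMem (by grind), Finset.card_insert_of_notMem hv.1.2]; omega
  · refine Wins.force (by omega) hc (v := u) (by grind) (by grind) (by grind)
      (fun B₁ hB₁ hcu => ?_)
    have hD' : BluePath B₁ e d (insert e (insert u T)) :=
      .cons (hB₁ heu) (by grind) (.cons hcu.symm (by grind) ((hD.mono hB).mono hB₁))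
    refine WinsFromEnds.absorb (q := q - 2) (fun p hp => hK p (by omega))
      (fun p hp => hK' p (by omega)) ((hP.mono hB).mono hB₁) hD' ?_ (by grind) ?_ hz hw hwd hwe haS
      (by grind) hb hbd hf (by grind) (by omega)
    · simp [heS, hu.1.1, hST]
    · rw [Finset.card_insert_of_notMem (by grind), Finset.card_insert_of_notMem hu.1.2]; omega

/-- Builder wins from a position with a blue path and a disjoint red edge. -/
theorem WinsFromEnds.redEdge (hK : ∀ p < q, WinsFromEnds V ℓ p)
    (hK' : ∀ p < q, WinsFromReserve V ℓ p) {x y z w a e : V} {S : Finset V}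
    (hq : 2 ≤ q) (hP : BluePath B x y S) (hS : ℓ ≤ S.card + q) (hz : R.Adj x z) (hw : R.Adj y w)
    (hze : z ≠ e) (hwe : w ≠ e) (hwa : w ≠ a) (haS : a ∉ S) (heS : e ∉ S) (hae : R.Adj a e)
    (hr : 3 * q / 2 ≤ r) : Wins ℓ r R B := by
  have hxS := hP.left_mem
  have hyS := hP.right_mem
  have hne := hae.ne
  obtain ⟨u, hu⟩ := Infinite.exists_notMem_finset (S ∪ {a, e, z, w})
  obtain ⟨v, hv⟩ := Infinite.exists_notMem_finset (S ∪ {a, e, z, w, u})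
  simp only [Finset.mem_union, Finset.mem_insert, Finset.mem_singleton, not_or] at hu hv
  -- After the general move and a red answer, `chain` would be needed at the excluded value `1`, so
  -- the four rounds are played out.
  by_cases hq3 : q = 3
  · refine .draw (by omega) (u := y) (v := a) (by grind) (fun R' hR hya => ?_)
      (fun B' hB hya => ?_)
    · refine Wins.force (by omega) ⟨hR hw, hya, hwa⟩ (v := v) (by grind) (by grind) (by grind)
        (fun B₁ hB₁ hyv => ?_)
      have h₁ := (hP.mono hB₁).snoc hv.1 hyv
      have ha' : Saturated R' a e y := ⟨hR hae, hya.symm, by grind⟩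
      refine Wins.force (by omega) ha' (v := v) (by grind) (by grind) (by grind)
        (fun B₂ hB₂ hav => ?_)
      have h₂ := (h₁.mono hB₂).snoc (u := a) (by grind) hav.symm
      refine Wins.force (by omega) ha' (v := u) (by grind) (by grind) (by grind)
        (fun B₃ hB₃ hau => ?_)
      have h₃ := (h₂.mono hB₃).snoc (u := u) (by grind) hau
      refine h₃.wins ?_ _
      rw [Finset.card_insert_of_notMem (by grind), Finset.card_insert_of_notMem (by grind),
        Finset.card_insert_of_notMem hv.1]
      omega
    · have h₁ := (hP.mono hB).snoc haS hya
      refine .draw (by omega) (u := x) (v := e) (by grind) (fun R' hR hxe => ?_)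
        (fun B₁ hB₁ hxe => ?_)
      · refine Wins.force (by omega) ⟨hR hz, hxe, hze⟩ (v := v) (by grind) (by grind) (by grind)
          (fun B₂ hB₂ hxv => ?_)
        have h₂ := (h₁.mono hB₂).symm.snoc (u := v) (by grind) hxv
        refine Wins.force (by omega) ⟨hR hae.symm, hxe.symm, by grind⟩ (v := v) (by grind)
          (by grind) (by grind) (fun B₃ hB₃ hev => ?_)
        have h₃ := (h₂.mono hB₃).snoc (u := e) (by grind) hev.symm
        refine h₃.wins ?_ _
        rw [Finset.card_insert_of_notMem (by grind), Finset.card_insert_of_notMem (by grind),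
          Finset.card_insert_of_notMem haS]
        omega
      · have h₂ := (h₁.mono hB₁).symm.snoc (u := e) (by grind) hxe
        refine h₂.wins_of_end ?_ hae.symm (by omega)
        rw [Finset.card_insert_of_notMem (by grind), Finset.card_insert_of_notMem haS]
        omega
  refine .draw (by omega) (u := e) (v := u) (by grind) (fun R' hR heu => ?_)
    (fun B' hB heu => ?_)
  · have he' : Saturated R' e a u := ⟨hR hae.symm, heu, by grind⟩
    refine Wins.force (by omega) he' (v := v) (by grind) (by grind) (by grind)
      (fun B₁ hB₁ hev => ?_)
    refine WinsFromEnds.chain (q := q - 2) (fun p hp => hK p (by omega))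
      (fun p hp => hK' p (by omega)) (by omega) (hP.mono hB₁)
      (.cons hev (by grind) (.single v)) ?_ he' (fun _ => by grind) ?_ (hR hz)
      (hR hw) (by grind) (by grind) (e := u) (a := a) (by grind) (by grind) (by grind) (by grind)
      (by grind) (by grind) (by grind) (by grind) (hR hae) heu.symm heS heS (by grind)
      (by omega)
    · simp [heS, hv.1]
    · rw [Finset.card_insert_of_notMem (by grind), Finset.card_singleton]; omega
  · refine WinsFromEnds.absorb (q := q - 2) (fun p hp => hK p (by omega))
      (fun p hp => hK' p (by omega)) (hP.mono hB) (.cons heu (by grind) (.single u)) ?_ (by grind)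
      ?_ hz hw (by grind) hwe haS (by grind) hae (by grind) hae.symm (by grind) (by omega)
    · simp [heS, hu.1]
    · rw [Finset.card_insert_of_notMem (by grind), Finset.card_singleton]; omega

/-- Builder draws an isolated edge: if red, it is the seed of a red path, and if blue, it is a
two-vertex path for the main path to absorb. -/
theorem winsFromEnds_of_lt (hK : ∀ p < q, WinsFromEnds V ℓ p)
    (hK' : ∀ p < q, WinsFromReserve V ℓ p) : WinsFromEnds V ℓ q := by
  intro r R B x y z w S hP hS hz hw hr
  rcases Nat.lt_or_ge q 2 with hq | hq
  · rcases Nat.eq_zero_or_pos q with rfl | hq0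
    · exact hP.wins hS _
    exact hP.wins_of_end (by omega) hw (by omega)
  obtain ⟨a, ha⟩ := Infinite.exists_notMem_finset (S ∪ {z, w})
  obtain ⟨e, he⟩ := Infinite.exists_notMem_finset (S ∪ {z, w, a})
  simp only [Finset.mem_union, Finset.mem_insert, Finset.mem_singleton, not_or] at ha he
  refine .draw (by omega) (u := a) (v := e) (by grind) (fun R' hR hae => ?_)
    (fun B' hB hae => ?_)
  · exact WinsFromEnds.redEdge hK hK' hq hP hS (hR hz) (hR hw) (by grind) (by grind) (by grind)
      ha.1 he.1 hae (by omega)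
  · have hST : Disjoint S {a, e} := by simp [ha.1, he.1]
    have hcard := Finset.card_union_of_disjoint hST
    rw [Finset.card_pair (by grind)] at hcard
    refine (hP.mono hB).attach hw (.cons hae (by grind) (.single e)) hST (by grind) (by grind)
      (by grind) (by omega) (fun B₁ hB₁ hP' => ?_) (fun R' B₁ hR hB₁ hya hP' => ?_)
    · exact WinsFromEnds.oneEnd (q := q - 2) (fun p hp => hK p (by omega)) hP' (by omega) hz
        (by omega)
    · exact hK (q - 2) (by omega) hP' (by omega) (hR hz) hya.symm (by omega)

/-- Again an isolated edge `ae` is drawn. If red, it serves as the red path of `chain`; if blue, the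
forced edge `ca` appends it to the reserve path, which the main path then absorbs. -/
theorem winsFromReserve_of_lt (hK : ∀ p < q, WinsFromEnds V ℓ p)
    (hK' : ∀ p < q, WinsFromReserve V ℓ p) : WinsFromReserve V ℓ q := by
  intro r R B x y z w c d c₁ c₂ S T hP hD hST hc hS hz hw hzd hwd hr
  have hxS := hP.left_mem
  have hyS := hP.right_mem
  have hcT := hD.left_mem
  have hdT := hD.right_mem
  have hdisj := Finset.disjoint_left.1 hST
  have hcard := Finset.card_union_of_disjoint hST
  obtain ⟨a, ha⟩ := Infinite.exists_notMem_finset (S ∪ T ∪ {z, w, c₁, c₂})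
  obtain ⟨e, he⟩ := Infinite.exists_notMem_finset (S ∪ T ∪ {z, w, c₁, c₂, a})
  simp only [Finset.mem_union, Finset.mem_insert, Finset.mem_singleton, not_or] at ha he
  rcases Nat.lt_or_ge q 2 with hq | hq
  · rcases Nat.eq_zero_or_pos q with rfl | hq0
    · refine .draw (by omega) (u := y) (v := a) (by grind) (fun R' hR hya => ?_)
        (fun B' hB hya => ?_)
      · refine Wins.force (by omega) ⟨hR hw, hya, by grind⟩ (v := d) (by grind) (by grind)
          (by grind) (fun B₁ hB₁ hyd => ?_)
        exact ((hP.mono hB₁).join (hD.mono hB₁).symm hST hyd).wins (by omega) _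
      · refine Wins.force (by omega) hc (v := a) (by grind) (by grind) (by grind)
          (fun B₁ hB₁ hca => ?_)
        have hST' : Disjoint (insert a S) T := by simp [ha.1.2, hST]
        refine ((((hP.mono hB).snoc ha.1.1 hya).mono hB₁).join ((hD.mono hB).mono hB₁) hST'
          hca.symm).wins ?_ _
        rw [Finset.card_union_of_disjoint hST', Finset.card_insert_of_notMem ha.1.1]
        omega
    · refine Wins.force (by omega) hc (v := a) (by grind) (by grind) (by grind)
        (fun B₁ hB₁ hca => ?_)
      have hST' : Disjoint S (insert a T) := by simp [ha.1.1, hST]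
      have hcard' := Finset.card_union_of_disjoint hST'
      rw [Finset.card_insert_of_notMem ha.1.2] at hcard'
      exact (hP.mono hB₁).attach hw (.cons hca.symm ha.1.2 (hD.mono hB₁)) hST' (by grind)
        (by grind) hwd (by omega) (fun B₂ hB₂ hP' => hP'.wins (by omega) _)
        (fun R' B₂ hR hB₂ hya hP' => hP'.wins (by omega) _)
  refine .draw (by omega) (u := a) (v := e) (by grind) (fun R' hR hae => ?_)
    (fun B' hB hae => ?_)
  · exact WinsFromEnds.chain hK hK' (by omega) hP hD hST (hc.mono hR) (fun _ => by omega) hS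
      (hR hz) (hR hw) hzd hwd (a := a) (e := e) (by grind) (by grind) (by grind) ha.1.1 ha.1.2
      he.1.1 he.1.2 (by grind) hae hae.symm he.1.1 ha.1.1 (by grind) (by omega)
  · refine Wins.force (by omega) hc (v := a) (by grind) (by grind) (by grind)
      (fun B₁ hB₁ hca => ?_)
    have hST' : Disjoint S (insert e (insert a T)) := by simp [ha.1.1, he.1.1, hST]
    have hcard' := Finset.card_union_of_disjoint hST'
    rw [Finset.card_insert_of_notMem (by grind), Finset.card_insert_of_notMem ha.1.2] at hcard'
    refine ((hP.mono hB).mono hB₁).attach hw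
      (.cons (hB₁ hae).symm (by grind) (.cons hca.symm ha.1.2 ((hD.mono hB).mono hB₁))) hST'
      (by grind) (by grind) hwd (by omega) (fun B₂ hB₂ hP' => ?_)
      (fun R' B₂ hR hB₂ hye hP' => ?_)
    · exact WinsFromEnds.oneEnd (q := q - 2) (fun p hp => hK p (by omega)) hP' (by omega) hz
        (by omega)
    · exact hK (q - 2) (by omega) hP' (by omega) (hR hz) hye.symm (by omega)

theorem winsFromEnds_and_winsFromReserve (V : Type*) [DecidableEq V] [Infinite V] (ℓ q : ℕ) :
    WinsFromEnds V ℓ q ∧ WinsFromReserve V ℓ q := by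
  induction q using Nat.strong_induction_on with
  | _ q ih =>
    exact ⟨winsFromEnds_of_lt (fun p hp => (ih p hp).1) (fun p hp => (ih p hp).2),
      winsFromReserve_of_lt (fun p hp => (ih p hp).1) (fun p hp => (ih p hp).2)⟩

theorem winsFromEnds (V : Type*) [DecidableEq V] [Infinite V] (ℓ q : ℕ) : WinsFromEnds V ℓ q :=
  (winsFromEnds_and_winsFromReserve V ℓ q).1

theorem winsFromReserve (V : Type*) [DecidableEq V] [Infinite V] (ℓ q : ℕ) :
    WinsFromReserve V ℓ q :=
  (winsFromEnds_and_winsFromReserve V ℓ q).2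

end Chains

/-! ### Builder's opening -/

section Opening

variable {V : Type*} [DecidableEq V] [Infinite V] {ℓ q r : ℕ} {R B : SimpleGraph V}

theorem BluePath.wins_of_ne {x y : V} {S : Finset V} (hP : BluePath B x y S) (hxy : x ≠ y)
    (hS : ℓ ≤ S.card + q) (hr : 3 * q / 2 + 2 ≤ r) : Wins ℓ r R B := by
  induction q generalizing r B x S with
  | zero => exact hP.wins hS _
  | succ q ih =>
    have hxS := hP.left_mem
    have hyS := hP.right_mem
    obtain ⟨v, hv⟩ := Infinite.exists_notMem_finset S
    have hxv : x ≠ v := by grind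
    have hyv : y ≠ v := by grind
    have hc := Finset.card_insert_of_notMem hv
    refine .draw (by omega) hxv (fun R' hR hxv => ?_) (fun B' hB hxv => ?_)
    · rcases Nat.eq_zero_or_pos q with rfl | hq
      · exact hP.symm.wins_of_end hS hxv (by omega)
      -- The same vertex `v` is tried at the other end: a second red answer gives both ends a red
      -- neighbour and saturates `v`, where a reserve path can start.
      refine .draw (by omega) hyv (fun R₁ hR₁ hyv => ?_) (fun B₁ hB₁ hyv => ?_)
      · obtain ⟨u, hu⟩ := Infinite.exists_notMem_finset (insert v S)
        simp only [Finset.mem_insert, not_or] at hu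
        have hs : Saturated R₁ v x y := ⟨(hR₁ hxv).symm, hyv.symm, hxy⟩
        refine Wins.force (by omega) hs (v := u) (by grind) (by grind) (by grind)
          (fun B₂ hB₂ hvu => ?_)
        refine winsFromReserve V ℓ (q - 1) (hP.mono hB₂) (.cons hvu (by grind) (.single u)) ?_
          hs ?_ (hR₁ hxv) hyv (by grind) (by grind) (by omega)
        · simp [hv, hu.2]
        · rw [Finset.card_insert_of_notMem (by grind), Finset.card_singleton]; omega
      -- The ends are now `x` and `v`, and the red edge `xv` serves as the red edge at both.
      · exact winsFromEnds V ℓ q ((hP.mono hB₁).snoc hv hyv) (by omega) hxv hxv.symm (by omega)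
    · exact ih (.cons hxv.symm hv (hP.mono hB)) (by grind) (by omega) (by omega)

/-- The recursion of `chain` without a main path. At the first blue answer the reserve path becomes
the main path, with `f` as red neighbour of its end `e` and `ab` as pendant red edge. -/
theorem BluePath.wins_of_chain {a b c d e f c₁ c₂ : V} {T : Finset V} (hD : BluePath B c d T)
    (hc : Saturated R c c₁ c₂) (hT : ℓ ≤ T.card + q) (haT : a ∉ T) (heT : e ∉ T)
    (hae : a ≠ e) (hb : R.Adj a b) (hf : R.Adj e f) (hbd : b ≠ d) (hr : 3 * q / 2 ≤ r) :
    Wins ℓ r R B := by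
  induction q using Nat.strong_induction_on generalizing r R B c c₁ c₂ e f T with
  | _ q ih =>
  have hcT := hD.left_mem
  obtain ⟨u, hu⟩ := Infinite.exists_notMem_finset (T ∪ {a, b, e, f, c₁, c₂})
  obtain ⟨v, hv⟩ := Infinite.exists_notMem_finset (T ∪ {a, b, e, f, c₁, c₂, u})
  simp only [Finset.mem_union, Finset.mem_insert, Finset.mem_singleton, not_or] at hu hv
  rcases Nat.lt_or_ge q 2 with hq | hq
  · rcases Nat.eq_zero_or_pos q with rfl | hq0
    · exact hD.wins hT _
    refine Wins.force (by omega) hc (v := v) (by grind) (by grind) (by grind)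
      (fun B' hB hcv => ?_)
    exact ((hD.mono hB).symm.snoc hv.1 hcv).wins
      (by rw [Finset.card_insert_of_notMem hv.1]; omega) _
  refine .draw (by omega) (u := e) (v := u) (by grind) (fun R' hR heu => ?_)
    (fun B' hB heu => ?_)
  · refine Wins.force (by omega) (hc.mono hR) (v := v) (by grind) (by grind) (by grind)
      (fun B₁ hB₁ hcv => ?_)
    have he' : Saturated R' e f u := ⟨hR hf, heu, by grind⟩
    refine Wins.force (by omega) he' (v := v) (by grind) (by grind) (by grind)
      (fun B₂ hB₂ hev => ?_)
    have hD' : BluePath B₂ e d (insert e (insert v T)) :=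
      .cons hev (by grind) (.cons (hB₂ hcv).symm (by grind) ((hD.mono hB₁).mono hB₂))
    refine ih (q - 2) (by omega) hD' he' ?_ (e := u) (by grind) (by grind) (by grind) (hR hb)
      heu.symm (by omega)
    rw [Finset.card_insert_of_notMem (by grind), Finset.card_insert_of_notMem hv.1]; omega
  · refine Wins.force (by omega) hc (v := u) (by grind) (by grind) (by grind)
      (fun B₁ hB₁ hcu => ?_)
    have hD' : BluePath B₁ e d (insert e (insert u T)) :=
      .cons (hB₁ heu) (by grind) (.cons hcu.symm (by grind) ((hD.mono hB).mono hB₁))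
    refine WinsFromEnds.pendant (q := q - 2) (fun p _ => winsFromEnds V ℓ p)
      (fun p _ => winsFromReserve V ℓ p) hD' ?_ hf (a := a) (by grind) hb hbd (by omega)
    rw [Finset.card_insert_of_notMem (by grind), Finset.card_insert_of_notMem hu.1]; omega

theorem wins_of_two_le (hℓ : 2 ≤ ℓ) (R B : SimpleGraph V) : Wins ℓ (3 * ℓ / 2) R B := by
  obtain ⟨a, -⟩ := Infinite.exists_notMem_finset (∅ : Finset V)
  obtain ⟨e, he⟩ := Infinite.exists_notMem_finset {a}
  obtain ⟨u, hu⟩ := Infinite.exists_notMem_finset {a, e}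
  obtain ⟨v, hv⟩ := Infinite.exists_notMem_finset {a, e, u}
  simp only [Finset.mem_insert, Finset.mem_singleton, not_or] at he hu hv
  refine .draw (by omega) (u := a) (v := e) (by grind) (fun R₁ hR₁ hae => ?_)
    (fun B₁ hB₁ hae => ?_)
  · refine .draw (by omega) (u := e) (v := u) (by grind) (fun R₂ hR₂ heu => ?_)
      (fun B₂ hB₂ heu => ?_)
    · have hs : Saturated R₂ e a u := ⟨(hR₂ hae).symm, heu, by grind⟩
      refine Wins.force (by omega) hs (v := v) (by grind) (by grind) (by grind)
        (fun B₃ hB₃ hev => ?_)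
      refine BluePath.wins_of_chain (q := ℓ - 2) (.cons hev (by grind) (.single v)) hs ?_ (a := a)
        (e := u) (by grind) (by grind) (by grind) (hR₂ hae) heu.symm (by grind) (by omega)
      rw [Finset.card_pair (by grind)]; omega
    · refine WinsFromEnds.pendant (q := ℓ - 2) (fun p _ => winsFromEnds V ℓ p)
        (fun p _ => winsFromReserve V ℓ p) (.cons heu (by grind) (.single u)) ?_ hae.symm (a := a)
        (by grind) hae (by grind) (by omega)
      rw [Finset.card_pair (by grind)]; omega
  · refine BluePath.wins_of_ne (q := ℓ - 2) (.cons hae (by grind) (.single e)) (by grind) ?_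
      (by omega)
    rw [Finset.card_pair (by grind)]; omega

end Opening

/-! ### Painter's strategy and the lower bound -/

section Painter

variable {V : Type*} [DecidableEq V]

/-- The number of edges in `r` that contain the vertex `v`. -/
def edgeDegree (r : Finset (Sym2 V)) (v : V) : ℕ := (r.filter (v ∈ ·)).card

theorem edgeDegree_insert {r : Finset (Sym2 V)} {e : Sym2 V} (he : e ∉ r) (v : V) :
    edgeDegree (insert e r) v = edgeDegree r v + if v ∈ e then 1 else 0 := by
  unfold edgeDegree
  rw [Finset.filter_insert]
  split_ifs with h
  · rw [Finset.card_insert_of_notMem (by simp [he])]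
  · simp

theorem exists_three_le_edgeDegree {r : Finset (Sym2 V)}
    (h : (completeBipartiteGraph (Fin 1) (Fin 3)).IsContained (fromEdgeSet (r : Set (Sym2 V)))) :
    ∃ v, 3 ≤ edgeDegree r v := by
  obtain ⟨f⟩ := h
  refine ⟨f (Sum.inl 0), ?_⟩
  have hadj : ∀ j : Fin 3, s(f (Sum.inl 0), f (Sum.inr j)) ∈ r := fun j => by
    have : (completeBipartiteGraph (Fin 1) (Fin 3)).Adj (Sum.inl 0) (Sum.inr j) := by
      simp [completeBipartiteGraph]
    have := f.toHom.map_adj this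
    rw [fromEdgeSet_adj] at this
    exact_mod_cast this.1
  have := Finset.card_le_card_of_injOn (s := (Finset.univ : Finset (Fin 3)))
    (t := r.filter (f (Sum.inl 0) ∈ ·)) (fun j => s(f (Sum.inl 0), f (Sum.inr j)))
    (fun j _ => by simp [hadj j]) (fun i _ j _ hij => by
      have h1 : f (Sum.inr i) = f (Sum.inr j) := Sym2.congr_right.1 hij
      simpa using f.injective h1)
  simpa [edgeDegree] using this

/-- This is the handshake identity, by double counting incidences over the finitely many vertices
that meet `r`. -/
theorem exists_card_edgeDegree {r : Finset (Sym2 V)} (hdiag : ∀ e ∈ r, ¬ e.IsDiag)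
    (hdeg : ∀ v, edgeDegree r v ≤ 2) : ∃ A₁ A₂ : Finset V, (∀ v, v ∈ A₁ ↔ edgeDegree r v = 1) ∧
      (∀ v, v ∈ A₂ ↔ edgeDegree r v = 2) ∧ 2 * r.card = A₁.card + 2 * A₂.card := by
  set s : Finset V := r.biUnion Sym2.toFinset with hs
  have hmem : ∀ v, 0 < edgeDegree r v → v ∈ s := by
    intro v hv
    obtain ⟨e, he⟩ := Finset.card_pos.1 hv
    rw [Finset.mem_filter] at he
    exact Finset.mem_biUnion.2 ⟨e, he.1, Sym2.mem_toFinset.2 he.2⟩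
  refine ⟨s.filter (edgeDegree r · = 1), s.filter (edgeDegree r · = 2), fun v => ?_, fun v => ?_,
    ?_⟩
  · simp only [Finset.mem_filter, and_iff_right_iff_imp]
    exact fun h => hmem v (by omega)
  · simp only [Finset.mem_filter, and_iff_right_iff_imp]
    exact fun h => hmem v (by omega)
  have hsum : ∑ v ∈ s, edgeDegree r v = ∑ e ∈ r, (s.filter (· ∈ e)).card :=
    Finset.sum_card_bipartiteAbove_eq_sum_card_bipartiteBelow (fun (v : V) (e : Sym2 V) => v ∈ e)
  have htwo : ∑ e ∈ r, (s.filter (· ∈ e)).card = ∑ e ∈ r, 2 := by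
    refine Finset.sum_congr rfl fun e he => ?_
    rw [← Sym2.card_toFinset_of_not_isDiag e (hdiag e he)]
    congr 1
    ext v
    simp only [Finset.mem_filter, Sym2.mem_toFinset, and_iff_right_iff_imp]
    exact fun hv => Finset.mem_biUnion.2 ⟨e, he, Sym2.mem_toFinset.2 hv⟩
  have hsplit : ∑ v ∈ s, edgeDegree r v =
      ∑ v ∈ s, ((if edgeDegree r v = 1 then 1 else 0) + 2 * if edgeDegree r v = 2 then 1 else 0) := by
    refine Finset.sum_congr rfl fun v _ => ?_
    have := hdeg v
    split_ifs <;> omega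
  rw [Finset.sum_add_distrib, ← Finset.mul_sum, ← Finset.card_filter, ← Finset.card_filter]
    at hsplit
  rw [Finset.sum_const, smul_eq_mul] at htwo
  omega

/-- The edges of `b` neither of whose ends is contained in two edges of `r`. -/
def uncovered (r b : Finset (Sym2 V)) : Finset (Sym2 V) :=
  {e ∈ b | ∀ x ∈ e.toFinset, edgeDegree r x ≠ 2}

theorem mem_uncovered {r b : Finset (Sym2 V)} {e : Sym2 V} :
    e ∈ uncovered r b ↔ e ∈ b ∧ ∀ x ∈ e, edgeDegree r x ≠ 2 := by
  simp only [uncovered, Finset.mem_filter, Sym2.mem_toFinset]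

/-- A vertex of `A` is the first end of at most one edge of the path and the second end of at most
one; the remaining edges are uncovered. -/
theorem le_card_of_isContained {r b : Finset (Sym2 V)} {ℓ : ℕ} {A : Finset V}
    (h : (pathGraph ℓ).IsContained (fromEdgeSet (b : Set (Sym2 V))))
    (hA : ∀ v, v ∈ A ↔ edgeDegree r v = 2) :
    ℓ ≤ b.card + 1 ∧ ℓ ≤ 2 * A.card + (uncovered r b).card + 1 := by
  obtain ⟨f⟩ := h
  rcases Nat.eq_zero_or_pos ℓ with rfl | hpos
  · simp
  obtain ⟨k, rfl⟩ : ∃ k, ℓ = k + 1 := ⟨ℓ - 1, by omega⟩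
  set g : Fin k → Sym2 V := fun i => s(f i.castSucc, f i.succ) with hg
  have hgb : ∀ i, g i ∈ b := fun i => by
    have : (pathGraph (k + 1)).Adj i.castSucc i.succ := by simp [pathGraph_adj]
    have := f.toHom.map_adj this
    rw [fromEdgeSet_adj] at this
    exact_mod_cast this.1
  have hinj : Function.Injective g := by
    intro i j hij
    have h1 := Sym2.eq_iff.1 hij
    rcases h1 with ⟨h1, -⟩ | ⟨h1, h2⟩
    · simpa using f.injective h1
    · have h1 := f.injective h1
      have h2 := f.injective h2
      simp only [Fin.ext_iff, Fin.val_castSucc, Fin.val_succ] at h1 h2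
      omega
  constructor
  · have := Finset.card_le_card_of_injOn (s := (Finset.univ : Finset (Fin k))) (t := b) g
      (fun i _ => hgb i) hinj.injOn
    simpa using this
  have h1 : (Finset.univ.filter fun i : Fin k => f i.castSucc ∈ A).card ≤ A.card :=
    Finset.card_le_card_of_injOn (fun i => f i.castSucc) (fun i hi => by simpa using hi)
      (fun i _ j _ hij => by
        have h1 := f.injective (show f i.castSucc = f j.castSucc from hij)
        simpa using h1)
  have h2 : (Finset.univ.filter fun i : Fin k => f i.succ ∈ A).card ≤ A.card :=
    Finset.card_le_card_of_injOn (fun i => f i.succ) (fun i hi => by simpa using hi)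
      (fun i _ j _ hij => by
        have h1 := f.injective (show f i.succ = f j.succ from hij)
        simpa using h1)
  have h3 : (Finset.univ.filter fun i : Fin k => f i.castSucc ∉ A ∧ f i.succ ∉ A).card ≤
      (uncovered r b).card := by
    refine Finset.card_le_card_of_injOn g (fun i hi => ?_) hinj.injOn
    have hi' : f i.castSucc ∉ A ∧ f i.succ ∉ A := by simpa using hi
    rw [hA, hA] at hi'
    rw [Finset.mem_coe, mem_uncovered]
    refine ⟨hgb i, fun x hx => ?_⟩
    rcases Sym2.mem_iff.1 hx with rfl | rfl
    · exact hi'.1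
    · exact hi'.2
  have h4 : (Finset.univ : Finset (Fin k)) ⊆
      (Finset.univ.filter fun i : Fin k => f i.castSucc ∈ A) ∪
      ((Finset.univ.filter fun i : Fin k => f i.succ ∈ A) ∪
        Finset.univ.filter fun i : Fin k => f i.castSucc ∉ A ∧ f i.succ ∉ A) := by
    intro i _
    simp only [Finset.mem_union, Finset.mem_filter, Finset.mem_univ, true_and]
    tauto
  have h5 := (Finset.card_le_card h4).trans (Finset.card_union_le _ _)
  have h6 := Finset.card_union_le (Finset.univ.filter fun i : Fin k => f i.succ ∈ A)
    (Finset.univ.filter fun i : Fin k => f i.castSucc ∉ A ∧ f i.succ ∉ A)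
  rw [Finset.card_univ, Fintype.card_fin] at h5
  omega

/-- The invariant of Painter's strategy: `r` and `b` are the red and the blue edges. Painter colours
an edge blue only if an end is in two red edges, or if with it there would be exactly `m` red edges
and no vertex in exactly one of them. -/
structure PainterInvariant (m : ℕ) (r b : Finset (Sym2 V)) : Prop where
  not_isDiag : ∀ e ∈ r, ¬ e.IsDiag
  not_isDiag_blue : ∀ e ∈ b, ¬ e.IsDiag
  edgeDegree_le : ∀ v, edgeDegree r v ≤ 2
  few : r.card + 1 < m → uncovered r b = ∅
  critical : r.card + 1 = m → ∀ e ∈ uncovered r b, ∀ x, edgeDegree r x = 1 ↔ x ∈ e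
  exists_edgeDegree_eq_one : r.card = m → ∃ x, edgeDegree r x = 1
  edgeDegree_eq_one : r.card = m → ∀ e ∈ uncovered r b, ∀ x ∈ e, edgeDegree r x = 1
  exists_notMem : r.card = m → ∀ e ∈ uncovered r b, ∃ x, x ∉ e ∧ edgeDegree r x = 1
  subsingleton : r.card = m → ∀ e ∈ uncovered r b, ∀ e' ∈ uncovered r b, e = e'

namespace PainterInvariant

variable {m : ℕ} {r b : Finset (Sym2 V)}

theorem empty (hm : 0 < m) : PainterInvariant m (∅ : Finset (Sym2 V)) ∅ := by
  have h : uncovered (∅ : Finset (Sym2 V)) ∅ = ∅ := rfl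
  constructor <;> simp [edgeDegree, h, hm.ne]

theorem insert_blue (h : PainterInvariant m r b) {e : Sym2 V}
    (hdiag : ¬ e.IsDiag) (he : ∃ x ∈ e, edgeDegree r x = 2) :
    PainterInvariant m r (insert e b) := by
  have hU : uncovered r (insert e b) = uncovered r b := by
    ext e'
    simp only [mem_uncovered, Finset.mem_insert]
    obtain ⟨x, hx, hx2⟩ := he
    constructor
    · rintro ⟨rfl | h1, h2⟩
      · exact absurd hx2 (h2 x hx)
      · exact ⟨h1, h2⟩
    · exact fun h => ⟨.inr h.1, h.2⟩
  constructor
  · exact h.not_isDiag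
  · exact Finset.forall_mem_insert .. |>.2 ⟨hdiag, h.not_isDiag_blue⟩
  · exact h.edgeDegree_le
  · rw [hU]; exact h.few
  · rw [hU]; exact h.critical
  · exact h.exists_edgeDegree_eq_one
  · rw [hU]; exact h.edgeDegree_eq_one
  · rw [hU]; exact h.exists_notMem
  · rw [hU]; exact h.subsingleton

/-- An end of `e` with red degree zero, or a vertex off `e` with red degree one, would have red
degree one after adding `e` to `r`. So the vertices of red degree one are exactly the ends of `e`.
-/
theorem insert_blue_of_critical (h : PainterInvariant m r b) {e : Sym2 V}
    (hdiag : ¬ e.IsDiag) (he : ∀ x ∈ e, edgeDegree r x < 2) (her : e ∉ r) (hr : r.card + 1 = m)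
    (hne : ∀ x, edgeDegree (insert e r) x ≠ 1) : PainterInvariant m r (insert e b) := by
  refine ⟨h.not_isDiag, Finset.forall_mem_insert .. |>.2 ⟨hdiag, h.not_isDiag_blue⟩,
    h.edgeDegree_le, fun h' => by omega, fun _ e' he' x => ?_,
    fun h' => by omega, fun h' => by omega, fun h' => by omega, fun h' => by omega⟩
  rw [mem_uncovered, Finset.mem_insert] at he'
  obtain ⟨rfl | h1, h2⟩ := he'
  · have h3 := hne x
    have h4 := he x
    rw [edgeDegree_insert her] at h3
    split_ifs at h3 with hx
    · have := h4 hx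
      simp only [hx, iff_true]; omega
    · simp only [hx, iff_false]; omega
  · exact h.critical hr e' (mem_uncovered.2 ⟨h1, h2⟩) x

theorem insert_red (h : PainterInvariant m r b) {e : Sym2 V} (hdiag : ¬ e.IsDiag)
    (he : ∀ x ∈ e, edgeDegree r x < 2) (her : e ∉ r)
    (hne : r.card + 1 = m → ∃ x, edgeDegree (insert e r) x = 1) :
    PainterInvariant m (insert e r) b := by
  have hcard := Finset.card_insert_of_notMem her
  have hU : uncovered (insert e r) b ⊆ uncovered r b := by
    intro e' he'
    rw [mem_uncovered] at he' ⊢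
    refine ⟨he'.1, fun x hx h2 => ?_⟩
    have h3 := he'.2 x hx
    rw [edgeDegree_insert her] at h3
    split_ifs at h3 with hxe
    · have := he x hxe; omega
    · omega
  -- An edge still uncovered after the `m`-th red edge is disjoint from that edge: otherwise a
  -- common end would rise from red degree one to two.
  have hone : r.card + 1 = m → ∀ e' ∈ uncovered (insert e r) b, ∀ x ∈ e',
      x ∉ e ∧ edgeDegree r x = 1 := by
    intro hr e' he' x hx
    have h1 := (h.critical hr e' (hU he') x).2 hx
    have h2 := (mem_uncovered.1 he').2 x hx
    rw [edgeDegree_insert her] at h2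
    split_ifs at h2 with hxe
    · omega
    · exact ⟨hxe, h1⟩
  refine ⟨fun e' he' => ?_, h.not_isDiag_blue, fun v => ?_, fun hr => ?_, fun hr e' he' => ?_,
    fun hr => ?_, fun hr e' he' x hx => ?_, fun hr e' he' => ?_, fun hr e₁ he₁ e₂ he₂ => ?_⟩
  · rcases Finset.mem_insert.1 he' with rfl | h1
    · exact hdiag
    · exact h.not_isDiag e' h1
  · rw [edgeDegree_insert her]
    have := h.edgeDegree_le v
    split_ifs with hv
    · have := he v hv; omega
    · omega
  · exact Finset.subset_empty.1 (h.few (by omega) ▸ hU)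
  · have := hU he'
    rw [h.few (by omega)] at this
    simp at this
  · exact hne (by omega)
  · obtain ⟨h1, h2⟩ := hone (by omega) e' he' x hx
    simp [edgeDegree_insert her, h1, h2]
  -- Outside `e'` every vertex on the new red edge had red degree zero, so it now has red degree
  -- one.
  · induction e with | _ u v
    have hu : u ∉ e' := fun hu => (hone (by omega) e' he' u hu).1 (Sym2.mem_mk_left u v)
    refine ⟨u, hu, ?_⟩
    have h1 := mt (h.critical (by omega) e' (hU he') u).1 hu
    have h2 := he u (Sym2.mem_mk_left u v)
    rw [edgeDegree_insert her, if_pos (Sym2.mem_mk_left u v)]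
    omega
  · refine Sym2.ext fun x => ?_
    rw [← h.critical (by omega) e₁ (hU he₁), ← h.critical (by omega) e₂ (hU he₂)]

/-- Builder has not won after fewer than `ℓ + ℓ / 2` rounds. -/
theorem not_won {ℓ : ℕ} (h : PainterInvariant (ℓ / 2) r b)
    (hrb : r.card + b.card + 1 ≤ ℓ + ℓ / 2) :
    ¬ ((completeBipartiteGraph (Fin 1) (Fin 3)).IsContained (fromEdgeSet (r : Set (Sym2 V))) ∨
      (pathGraph ℓ).IsContained (fromEdgeSet (b : Set (Sym2 V)))) := by
  rintro (h' | h')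
  · obtain ⟨v, hv⟩ := exists_three_le_edgeDegree h'
    have := h.edgeDegree_le v
    omega
  obtain ⟨A₁, A₂, hA₁, hA₂, hA⟩ := exists_card_edgeDegree h.not_isDiag h.edgeDegree_le
  obtain ⟨hb, hU⟩ := le_card_of_isContained h' hA₂
  rcases lt_trichotomy (r.card + 1) (ℓ / 2) with hr | hr | hr
  · rw [h.few hr, Finset.card_empty] at hU
    omega
  · have hne : (uncovered r b).Nonempty := Finset.card_pos.1 (by omega)
    obtain ⟨e, he⟩ := hne
    have h1 : (uncovered r b).card ≤ 1 := Finset.card_le_one.2 fun e₁ he₁ e₂ he₂ =>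
      Sym2.ext fun x => by rw [← h.critical hr e₁ he₁, ← h.critical hr e₂ he₂]
    have h2 : A₁.Nonempty := by
      induction e with | _ u v
      exact ⟨u, (hA₁ u).2 ((h.critical hr _ he u).2 (Sym2.mem_mk_left u v))⟩
    have := h2.card_pos
    omega
  · have hr : r.card = ℓ / 2 := by omega
    obtain ⟨x, hx⟩ := h.exists_edgeDegree_eq_one hr
    have h1 : 0 < A₁.card := Finset.card_pos.2 ⟨x, (hA₁ x).2 hx⟩
    have h2 : (uncovered r b).card ≤ 1 := Finset.card_le_one.2 (h.subsingleton hr)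
    rcases (uncovered r b).eq_empty_or_nonempty with hU0 | ⟨e, he⟩
    · rw [hU0, Finset.card_empty] at hU
      omega
    -- The two ends of `e` and `y` give `3 ≤ A₁.card`, which outweighs the one uncovered edge.
    · obtain ⟨y, hy, hy1⟩ := h.exists_notMem hr e he
      have hsub : insert y {x ∈ A₁ | x ∈ e} ⊆ A₁ :=
        Finset.insert_subset ((hA₁ y).2 hy1) (Finset.filter_subset _ _)
      have h3 := Finset.card_le_card hsub
      rw [Finset.card_insert_of_notMem (by simp [hy])] at h3
      have h4 : e.toFinset ⊆ {x ∈ A₁ | x ∈ e} := fun x hx => by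
        rw [Sym2.mem_toFinset] at hx
        exact Finset.mem_filter.2 ⟨(hA₁ x).2 (h.edgeDegree_eq_one hr e he x hx), hx⟩
      have h5 := Finset.card_le_card h4
      rw [Sym2.card_toFinset_of_not_isDiag e (h.not_isDiag_blue e (mem_uncovered.1 he).1)] at h5
      omega

theorem not_builderWinsWithin {ℓ : ℕ} {n : ℕ} :
    ∀ {r b : Finset (Sym2 V)}, PainterInvariant (ℓ / 2) r b →
      r.card + b.card + n + 1 ≤ ℓ + ℓ / 2 →
      ¬ Wins ℓ n (fromEdgeSet (r : Set (Sym2 V))) (fromEdgeSet (b : Set (Sym2 V))) := by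
  induction n with
  | zero => exact fun h hn => h.not_won (by omega)
  | succ n ih =>
    rintro r b h hn (hw | ⟨u, v, huv, hur, hub, h4, h5⟩)
    · exact h.not_won (by omega) hw
    have her : s(u, v) ∉ r := fun h' => hur ((fromEdgeSet_adj _).2 ⟨h', huv⟩)
    have heb : s(u, v) ∉ b := fun h' => hub ((fromEdgeSet_adj _).2 ⟨h', huv⟩)
    have hins : ∀ t : Finset (Sym2 V), fromEdgeSet (t : Set (Sym2 V)) ⊔ edge u v =
        fromEdgeSet ((insert s(u, v) t : Finset (Sym2 V)) : Set (Sym2 V)) := fun t => by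
      rw [edge, ← fromEdgeSet_union, Finset.coe_insert, Set.insert_eq, Set.union_comm]
    rw [hins] at h4 h5
    have hcr := Finset.card_insert_of_notMem her
    have hcb := Finset.card_insert_of_notMem heb
    have hdiag : ¬ s(u, v).IsDiag := by simpa using huv
    by_cases h2 : ∃ x ∈ s(u, v), edgeDegree r x = 2
    · exact ih (h.insert_blue hdiag h2) (by omega) h5
    have hlt : ∀ x ∈ s(u, v), edgeDegree r x < 2 := fun x hx => by
      have := h.edgeDegree_le x
      have : edgeDegree r x ≠ 2 := fun h' => h2 ⟨x, hx, h'⟩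
      omega
    -- Painter's second exception: refuse the red edge that would complete a union of cycles with `ℓ
    -- / 2` edges.
    by_cases hc : r.card + 1 = ℓ / 2 ∧ ∀ x, edgeDegree (insert s(u, v) r) x ≠ 1
    · exact ih (h.insert_blue_of_critical hdiag hlt her hc.1 hc.2) (by omega) h5
    · refine ih (h.insert_red hdiag hlt her fun hr => ?_) (by omega) h4
      by_contra hne
      exact hc ⟨hr, fun x hx => hne ⟨x, hx⟩⟩

end PainterInvariant

end Painter

theorem theorem1 (V : Type*) [Infinite V] (ℓ : ℕ) (hℓ : 2 ≤ ℓ) :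
    onlineRamseyNumber V (completeBipartiteGraph (Fin 1) (Fin 3)) (SimpleGraph.pathGraph ℓ) =
      ((3 * ℓ / 2 : ℕ) : ℕ∞) := by
  classical
  refine le_antisymm (iInf₂_le (3 * ℓ / 2) (wins_of_two_le hℓ ⊥ ⊥)) (le_iInf₂ fun n hn => ?_)
  rw [Nat.cast_le]
  by_contra hlt
  refine PainterInvariant.not_builderWinsWithin (ℓ := ℓ) (n := n)
    (PainterInvariant.empty (V := V) (by omega)) ?_ ?_
  · simp only [Finset.card_empty]; omega
  · simpa using hn
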